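/- Let $n\ge 1$ be an integer and let $b,c\ge 0$ be integers, not both $0$. Let \[ P=\Bigl\{x\in\mathbf R^{n-1} \;\Bigm|\; c\cdot(|x_1|+\cdots+|x_{n-1}|)+b\cdot\max\{|x_1|,\ldots,|x_{n-1}|\}\le 1\Bigr\} \] (for $n=1$ the maximum over the empty set is read as $0$). Then every dilate $kP$, $k\in\{0,1,2,\dots\}$, contains only finitely many points of $\mathbf Z^{n-1}$, and the Ehrhart series of $P$, that is, the formal power series \[ \mathrm{Ehr}_P(t)=\sum_{k\ge 0}\bigl|kP\cap\mathbf Z^{n-1}\bigr|\,t^k\in\mathbf Z[[t]], \] is \[ \mathrm{Ehr}_P(t)= \begin{cases} [c]_t\,(1+t^c)^{n-1}/(1-t^c)^n & \text{if } b=0,\\[1ex] [b]_t\displaystyle\sum_{k\ge 0}\bigl([k+1]_{t^c}+t^c\,[k]_{t^c}\bigr)^{n-1}\,t^{bk} & \text{if } b\ge 1, \end{cases} \] where $[k]_q=1+q+q^2+\cdots+q^{k-1}$ (so $[0]_q=0$, and $[k]_{t^0}=k$), $1-t^c$ is a unit of $\mathbf Z[[t]]$ in the first case, and the infinite sum in the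 second case converges in $\mathbf Z[[t]]$ (coefficientwise, each coefficient being eventually constant along the partial sums). -/

import Mathlib

open scoped Pointwise PowerSeries PowerSeries.WithPiTopology

/-- The lattice points `S ∩ ℤ^d` of a set `S ⊆ ℝ^d`. -/
def latticePoints {d : ℕ} (S : Set (Fin d → ℝ)) : Set (Fin d → ℤ) :=
  {z | (fun i => (z i : ℝ)) ∈ S}

/-- The Ehrhart series `∑_{k ≥ 0} |kP ∩ ℤ^d| t^k`, a formal power series in `t`
(meaningful when every dilate `kP` contains only finitely many lattice points). -/
noncomputable def ehrhartSeries {d : ℕ} (P : Set (Fin d → ℝ)) : ℤ⟦X⟧ :=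
  PowerSeries.mk fun k => ((latticePoints ((k : ℝ) • P)).ncard : ℤ)

/-- The `q`-number `[k]_q = 1 + q + ⋯ + q^(k-1)`. -/
def qNumber {R : Type*} [Semiring R] (k : ℕ) (q : R) : R :=
  ∑ i ∈ Finset.range k, q ^ i

/-- `{x ∈ ℝ^d | c (|x_1| + ⋯ + |x_d|) + b max {|x_1|, …, |x_d|} ≤ 1}`.
The supremum over the finite index set is the maximum, and it is `0` if `d = 0`. -/
noncomputable def almostConstantPolytope (d b c : ℕ) : Set (Fin d → ℝ) :=
  {x | (c : ℝ) * ∑ i, |x i| + (b : ℝ) * ⨆ i, |x i| ≤ 1}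

/-! An integer vector `z` lies in `mP` iff `c|z|₁ + b|z|_∞ ≤ m`. For `b ≥ 1`, division by `b` shows
this holds iff `m = c|z|₁ + bk + r` for some `k ≥ |z|_∞` and `0 ≤ r < b`, and then `k, r` are
unique. Summing `t^m`, the remainders give `[b]_t`, the quotients give `t^(bk)`, and the box `|z|_∞
≤ k` gives `∑ t^(c|z|₁)`, which factors over the coordinates (`sum_latticeBox_pow`). For `b = 0`,
modulo `t^(N+1)` the series is the generating function of the box of radius `N` divided by `1 - t`;
multiplying by `(1 - t^c)^n` gives the closed form. -/

/-- The largest absolute value of a coordinate of an integer vector. -/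
def supNatAbs {d : ℕ} (z : Fin d → ℤ) : ℕ :=
  Finset.univ.sup fun i => (z i).natAbs

/-- The sum of the absolute values of the coordinates of an integer vector. -/
def sumNatAbs {d : ℕ} (z : Fin d → ℤ) : ℕ :=
  ∑ i, (z i).natAbs

/-- The integer vectors whose coordinates have absolute value at most `k`. -/
noncomputable def latticeBox (d k : ℕ) : Finset (Fin d → ℤ) :=
  Fintype.piFinset fun _ => Finset.Icc (-(k : ℤ)) k

lemma mem_latticeBox {d k : ℕ} {z : Fin d → ℤ} : z ∈ latticeBox d k ↔ supNatAbs z ≤ k := by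
  simp only [latticeBox, supNatAbs, Fintype.mem_piFinset, Finset.mem_Icc, Finset.sup_le_iff,
    Finset.mem_univ, forall_true_left]
  exact forall_congr' fun _ => by omega

lemma supNatAbs_le_sumNatAbs {d : ℕ} (z : Fin d → ℤ) : supNatAbs z ≤ sumNatAbs z :=
  Finset.sup_le fun _ hi =>
    Finset.single_le_sum (f := fun i => (z i).natAbs) (fun _ _ => Nat.zero_le _) hi

lemma iSup_abs_intCast {d : ℕ} (z : Fin d → ℤ) :
    ⨆ i, |(z i : ℝ)| = (supNatAbs z : ℝ) := by
  have habs (i : Fin d) : |(z i : ℝ)| = ((z i).natAbs : ℝ) := by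
    rw [Nat.cast_natAbs, Int.cast_abs]
  simp only [habs]
  rcases isEmpty_or_nonempty (Fin d) with h | h
  · simp [supNatAbs, Real.iSup_of_isEmpty]
  · apply le_antisymm
    · exact ciSup_le fun i => by
        exact_mod_cast Finset.le_sup (f := fun i => (z i).natAbs) (Finset.mem_univ i)
    · obtain ⟨i, -, hi⟩ := Finset.exists_mem_eq_sup Finset.univ Finset.univ_nonempty
        fun i => (z i).natAbs
      rw [supNatAbs, hi]
      exact le_ciSup (f := fun i => ((z i).natAbs : ℝ)) (Set.finite_range _).bddAbove i

lemma sum_abs_intCast {d : ℕ} (z : Fin d → ℤ) :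
    ∑ i, |(z i : ℝ)| = (sumNatAbs z : ℝ) := by
  rw [sumNatAbs, Nat.cast_sum]
  exact Finset.sum_congr rfl fun i _ => by rw [Nat.cast_natAbs, Int.cast_abs]

lemma supNatAbs_eq_zero {d : ℕ} {z : Fin d → ℤ} : supNatAbs z = 0 ↔ z = 0 := by
  simp [supNatAbs, funext_iff]

/-- Confines the lattice points of `mP` to a finite box; for `b = 0` this uses `|z|_∞ ≤ |z|₁`. -/
lemma supNatAbs_le_of_weight_le {d b c m : ℕ} (hbc : ¬ (b = 0 ∧ c = 0)) {z : Fin d → ℤ}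
    (h : c * sumNatAbs z + b * supNatAbs z ≤ m) : supNatAbs z ≤ m := by
  have hz := supNatAbs_le_sumNatAbs z
  rcases Nat.eq_zero_or_pos b with hb | hb
  · have := Nat.le_mul_of_pos_left (sumNatAbs z) (Nat.pos_of_ne_zero fun hc => hbc ⟨hb, hc⟩)
    omega
  · have := Nat.le_mul_of_pos_left (supNatAbs z) hb
    omega

lemma mem_latticePoints_smul {d b c : ℕ} (hbc : ¬ (b = 0 ∧ c = 0)) (m : ℕ) (z : Fin d → ℤ) :
    z ∈ latticePoints ((m : ℝ) • almostConstantPolytope d b c) ↔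
      c * sumNatAbs z + b * supNatAbs z ≤ m := by
  rw [latticePoints, Set.mem_ofPred_eq]
  rcases Nat.eq_zero_or_pos m with rfl | hm
  -- Scaling by `0` is not invertible, but `0 • P = {0}` as `P` is nonempty.
  · have hne : (almostConstantPolytope d b c).Nonempty := ⟨0, by simp [almostConstantPolytope]⟩
    rw [Nat.cast_zero, Set.zero_smul_set hne, Set.mem_zero]
    constructor
    · intro h
      obtain rfl : z = 0 := funext fun i => by simpa using congrFun h i
      simp [sumNatAbs, supNatAbs]
    · intro h
      have h0 := supNatAbs_le_of_weight_le hbc h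
      rw [Nat.le_zero, supNatAbs_eq_zero] at h0
      subst h0
      ext i
      simp
  · have hm' : (0 : ℝ) < m := Nat.cast_pos.2 hm
    rw [Set.mem_smul_set_iff_inv_smul_mem₀ hm'.ne', almostConstantPolytope, Set.mem_ofPred_eq]
    simp only [Pi.smul_apply, smul_eq_mul, abs_mul, abs_of_pos (inv_pos.2 hm')]
    rw [← Finset.mul_sum, ← Real.mul_iSup_of_nonneg (inv_pos.2 hm').le, sum_abs_intCast,
      iSup_abs_intCast]
    have key : (c : ℝ) * ((m : ℝ)⁻¹ * sumNatAbs z) + b * ((m : ℝ)⁻¹ * supNatAbs z) =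
        ((c * sumNatAbs z + b * supNatAbs z : ℕ) : ℝ) / m := by
      push_cast
      field_simp
    rw [key, div_le_one hm', Nat.cast_le]

/-- The free `N ≥ m` lets one box serve all coefficients up to `N`. -/
lemma latticePoints_smul_eq {d b c : ℕ} (hbc : ¬ (b = 0 ∧ c = 0)) (m : ℕ) {N : ℕ} (hN : m ≤ N) :
    latticePoints ((m : ℝ) • almostConstantPolytope d b c) =
      ↑((latticeBox d N).filter fun z => c * sumNatAbs z + b * supNatAbs z ≤ m) := by
  ext z
  rw [mem_latticePoints_smul hbc, Finset.coe_filter, Set.mem_ofPred_eq, mem_latticeBox]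
  exact ⟨fun h => ⟨(supNatAbs_le_of_weight_le hbc h).trans hN, h⟩, fun h => h.2⟩

lemma coeff_ehrhartSeries {d b c : ℕ} (hbc : ¬ (b = 0 ∧ c = 0)) (m : ℕ) {N : ℕ} (hN : m ≤ N) :
    PowerSeries.coeff m (ehrhartSeries (almostConstantPolytope d b c)) =
      ∑ z ∈ latticeBox d N, if c * sumNatAbs z + b * supNatAbs z ≤ m then (1 : ℤ) else 0 := by
  rw [ehrhartSeries, PowerSeries.coeff_mk, latticePoints_smul_eq hbc m hN,
    Set.ncard_coe_finset, Finset.card_filter, Nat.cast_sum]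
  exact Finset.sum_congr rfl fun z _ => by split_ifs <;> simp

section QNumber

variable {R : Type*} [CommRing R]

lemma sum_Icc_pow_natAbs (k : ℕ) (q : R) :
    ∑ j ∈ Finset.Icc (-(k : ℤ)) k, q ^ j.natAbs = qNumber (k + 1) q + q * qNumber k q := by
  induction k with
  | zero => simp [qNumber]
  | succ k ih =>
    have hIcc : Finset.Icc (-((k + 1 : ℕ) : ℤ)) ((k + 1 : ℕ) : ℤ) =
        insert (-((k + 1 : ℕ) : ℤ)) (insert ((k + 1 : ℕ) : ℤ) (Finset.Icc (-(k : ℤ)) k)) := by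
      ext j
      simp only [Finset.mem_insert, Finset.mem_Icc]
      omega
    rw [hIcc, Finset.sum_insert, Finset.sum_insert, ih, Int.natAbs_neg, Int.natAbs_natCast]
    · simp only [qNumber, Finset.sum_range_succ]
      ring
    · simp only [Finset.mem_Icc]
      omega
    · simp only [Finset.mem_insert, Finset.mem_Icc]
      omega

lemma sum_latticeBox_pow (d k : ℕ) (q : R) :
    ∑ z ∈ latticeBox d k, q ^ sumNatAbs z = (qNumber (k + 1) q + q * qNumber k q) ^ d := by
  rw [← sum_Icc_pow_natAbs, latticeBox]
  simp only [sumNatAbs, ← Finset.prod_pow_eq_pow_sum]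
  rw [← Finset.prod_univ_sum (fun _ : Fin d => Finset.Icc (-(k : ℤ)) k)
    (fun _ j => q ^ j.natAbs)]
  simp

lemma qNumber_mul_one_sub (k : ℕ) (q : R) : qNumber k q * (1 - q) = 1 - q ^ k := by
  rw [qNumber, geom_sum_mul_neg]

end QNumber

-- Multiplying by `mk 1`, which is `1/(1 - X)`, turns counts of `c|z|₁ = m` into counts of `c|z|₁ ≤
-- m`.
open PowerSeries in
lemma X_pow_dvd_ehrhartSeries_sub {d c : ℕ} (hc : c ≠ 0) (N : ℕ) :
    (X : ℤ⟦X⟧) ^ (N + 1) ∣ ehrhartSeries (almostConstantPolytope d 0 c) -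
      (qNumber (N + 1) (X ^ c) + X ^ c * qNumber N (X ^ c)) ^ d * mk 1 := by
  rw [X_pow_dvd_iff]
  intro m hm
  rw [map_sub, coeff_ehrhartSeries (fun h => hc h.2) m (Nat.le_of_lt_succ hm),
    ← sum_latticeBox_pow, Finset.sum_mul, map_sum, ← Finset.sum_sub_distrib]
  refine Finset.sum_eq_zero fun z _ => ?_
  rw [← pow_mul, coeff_X_pow_mul', sub_eq_zero]
  simp

open PowerSeries in
lemma ehrhartSeries_mul_one_sub_pow {d c : ℕ} (hc : c ≠ 0) :
    ehrhartSeries (almostConstantPolytope d 0 c) * (1 - X ^ c) ^ (d + 1) =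
      qNumber c X * (1 + X ^ c) ^ d := by
  have hdvd (N : ℕ) : (X : ℤ⟦X⟧) ^ (N + 1) ∣
      ehrhartSeries (almostConstantPolytope d 0 c) * (1 - X ^ c) ^ (d + 1) -
        qNumber c X * (1 + X ^ c) ^ d := by
    set q : ℤ⟦X⟧ := X ^ c with hq
    set A : ℤ⟦X⟧ := qNumber (N + 1) q + q * qNumber N q with hA
    -- The error term vanishes modulo `X^(N+1)` because `c ≥ 1`.
    have hAq : A * (1 - q) = 1 + q - 2 * q ^ (N + 1) := by
      rw [hA, add_mul, mul_assoc, qNumber_mul_one_sub, qNumber_mul_one_sub]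
      ring
    have hgeom : (mk 1 : ℤ⟦X⟧) * (1 - q) = qNumber c X := by
      rw [hq, ← qNumber_mul_one_sub, mul_comm (qNumber c X), ← mul_assoc, mk_one_mul_one_sub_eq_one,
        one_mul]
    have hXq : (X : ℤ⟦X⟧) ^ (N + 1) ∣ q ^ (N + 1) := pow_dvd_pow_of_dvd (dvd_pow_self X hc) _
    have hpow : (X : ℤ⟦X⟧) ^ (N + 1) ∣ (A * (1 - q)) ^ d - (1 + q) ^ d := by
      refine dvd_trans ?_ (sub_dvd_pow_sub_pow _ _ d)
      rw [hAq, show 1 + q - 2 * q ^ (N + 1) - (1 + q) = q ^ (N + 1) * (-2) by ring]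
      exact hXq.mul_right _
    have hE := X_pow_dvd_ehrhartSeries_sub (d := d) hc N
    rw [← hq, ← hA] at hE
    have hsum := (hE.mul_right ((1 - q) ^ (d + 1))).add (hpow.mul_right (qNumber c X))
    convert hsum using 1
    rw [← hgeom, mul_pow]
    ring
  rw [← sub_eq_zero]
  ext m
  exact X_pow_dvd_iff.1 (hdvd m) m (Nat.lt_succ_self m)

/-- Only the remainder and quotient of `m - s` by `b` can contribute, and the quotient is at least
`M` iff `s + b * M ≤ m`. -/
lemma sum_sum_ite_euclidean_division {b : ℕ} (hb : 1 ≤ b) (s M m : ℕ) :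
    (∑ r ∈ Finset.range b, ∑ k ∈ Finset.range (m + 1),
      if M ≤ k ∧ m = s + b * k + r then (1 : ℤ) else 0) =
      if s + b * M ≤ m then 1 else 0 := by
  rw [← Finset.sum_product']
  split_ifs with h
  · have hdiv := Nat.div_add_mod (m - s) b
    have hmod := Nat.mod_lt (m - s) hb
    have hM : M ≤ (m - s) / b := (Nat.le_div_iff_mul_le hb).2 (by rw [mul_comm]; omega)
    have hk : (m - s) / b ≤ m := (Nat.div_le_self _ _).trans (Nat.sub_le _ _)
    rw [Finset.sum_eq_single ((m - s) % b, (m - s) / b)]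
    · rw [if_pos ⟨hM, by dsimp only; omega⟩]
    · rintro ⟨r, k⟩ hrk hne
      rw [if_neg]
      rintro ⟨-, hm⟩
      dsimp only at hm
      rw [Finset.mem_product, Finset.mem_range] at hrk
      have hms : m - s = r + b * k := by omega
      refine hne (Prod.ext ?_ ?_)
      · rw [hms, Nat.add_mul_mod_self_left, Nat.mod_eq_of_lt hrk.1]
      · rw [hms, Nat.add_mul_div_left _ _ hb, Nat.div_eq_of_lt hrk.1, zero_add]
    · intro hmem
      exact absurd (Finset.mem_product.2 ⟨Finset.mem_range.2 hmod,
        Finset.mem_range.2 (Nat.lt_succ_of_le hk)⟩) hmem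
  · refine Finset.sum_eq_zero fun p _ => if_neg ?_
    rintro ⟨hMk, hm⟩
    have := Nat.mul_le_mul_left b hMk
    omega

open PowerSeries in
lemma coeff_qNumber_mul_sum {d b c : ℕ} (hb : 1 ≤ b) (m : ℕ) :
    coeff m (qNumber b (X : ℤ⟦X⟧) * ∑ k ∈ Finset.range (m + 1),
      (qNumber (k + 1) ((X : ℤ⟦X⟧) ^ c) + X ^ c * qNumber k (X ^ c)) ^ d * X ^ (b * k)) =
      coeff m (ehrhartSeries (almostConstantPolytope d b c)) := by
  have hbox (k : ℕ) (hk : k ∈ Finset.range (m + 1)) :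
      latticeBox d k = (latticeBox d m).filter fun z => supNatAbs z ≤ k := by
    ext z
    rw [Finset.mem_range] at hk
    rw [Finset.mem_filter, mem_latticeBox, mem_latticeBox]
    omega
  rw [coeff_ehrhartSeries (by omega) m le_rfl, qNumber, Finset.sum_mul_sum, map_sum]
  simp only [map_sum]
  have hterm (r k : ℕ) (hk : k ∈ Finset.range (m + 1)) :
      coeff m ((X : ℤ⟦X⟧) ^ r *
        ((qNumber (k + 1) (X ^ c) + X ^ c * qNumber k (X ^ c)) ^ d * X ^ (b * k))) =
      ∑ z ∈ latticeBox d m,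
        if supNatAbs z ≤ k ∧ m = c * sumNatAbs z + b * k + r then (1 : ℤ) else 0 := by
    rw [← sum_latticeBox_pow, hbox k hk, Finset.sum_mul, Finset.mul_sum, map_sum,
      Finset.sum_filter]
    refine Finset.sum_congr rfl fun z _ => ?_
    rw [← pow_mul, ← pow_add, ← pow_add, coeff_X_pow, add_comm r, ite_and]
  rw [Finset.sum_congr rfl fun r _ => Finset.sum_congr rfl fun k hk => hterm r k hk]
  simp only [← sum_sum_ite_euclidean_division hb]
  rw [Finset.sum_comm (s := latticeBox d m)]
  exact Finset.sum_congr rfl fun r _ => Finset.sum_comm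

-- As `b ≥ 1`, terms with `k > m` do not reach the coefficient of `X^m`.
open PowerSeries in
lemma hasSum_mul_X_pow {b : ℕ} (hb : 1 ≤ b) (f : ℕ → ℤ⟦X⟧) :
    HasSum (fun k => f k * X ^ (b * k))
      (mk fun m => coeff m (∑ k ∈ Finset.range (m + 1), f k * X ^ (b * k))) := by
  rw [PowerSeries.WithPiTopology.hasSum_iff_hasSum_coeff]
  intro m
  rw [coeff_mk, map_sum]
  refine hasSum_sum_of_ne_finset_zero fun k hk => ?_
  rw [Finset.mem_range, not_lt] at hk
  rw [coeff_mul_X_pow', if_neg]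
  have := Nat.le_mul_of_pos_left k hb
  omega

open PowerSeries in
lemma X_pow_dvd_tsum_mul_X_pow_sub {b : ℕ} (hb : 1 ≤ b) (f : ℕ → ℤ⟦X⟧) (m : ℕ) :
    X ^ (m + 1) ∣ (∑' k, f k * X ^ (b * k)) - ∑ k ∈ Finset.range (m + 1), f k * X ^ (b * k) := by
  rw [(hasSum_mul_X_pow hb f).tsum_eq, X_pow_dvd_iff]
  intro j hj
  rw [map_sub, coeff_mk, sub_eq_zero, map_sum, map_sum]
  refine Finset.sum_subset (Finset.range_mono hj) fun k _ hk => ?_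
  rw [Finset.mem_range, not_lt] at hk
  rw [coeff_mul_X_pow', if_neg]
  have := Nat.le_mul_of_pos_left k hb
  omega

theorem mainTheorem8 (n : ℕ) (hn : 1 ≤ n) (b c : ℕ) (hbc : ¬ (b = 0 ∧ c = 0)) :
    (∀ k : ℕ, (latticePoints ((k : ℝ) • almostConstantPolytope (n - 1) b c)).Finite) ∧
    (b = 0 →
      IsUnit ((1 - PowerSeries.X ^ c : ℤ⟦X⟧) ^ n) ∧
      ehrhartSeries (almostConstantPolytope (n - 1) b c) =
        qNumber c (PowerSeries.X : ℤ⟦X⟧) * (1 + PowerSeries.X ^ c) ^ (n - 1) *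
          Ring.inverse ((1 - PowerSeries.X ^ c) ^ n)) ∧
    (1 ≤ b →
      Summable (fun k : ℕ =>
        (qNumber (k + 1) ((PowerSeries.X : ℤ⟦X⟧) ^ c) +
          PowerSeries.X ^ c * qNumber k (PowerSeries.X ^ c)) ^ (n - 1) *
            PowerSeries.X ^ (b * k)) ∧
      ehrhartSeries (almostConstantPolytope (n - 1) b c) =
        qNumber b (PowerSeries.X : ℤ⟦X⟧) *
          ∑' k : ℕ,
            (qNumber (k + 1) ((PowerSeries.X : ℤ⟦X⟧) ^ c) +
              PowerSeries.X ^ c * qNumber k (PowerSeries.X ^ c)) ^ (n - 1) *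
                PowerSeries.X ^ (b * k)) := by
  obtain ⟨d, rfl⟩ := Nat.exists_eq_add_of_le' hn
  rw [Nat.add_sub_cancel]
  refine ⟨fun k => ?_, ?_, fun hb => ⟨(hasSum_mul_X_pow hb _).summable, ?_⟩⟩
  · rw [latticePoints_smul_eq hbc k le_rfl]
    exact Finset.finite_toSet _
  · rintro rfl
    have hc : c ≠ 0 := fun h => hbc ⟨rfl, h⟩
    have hu : IsUnit ((1 - PowerSeries.X ^ c : ℤ⟦X⟧) ^ (d + 1)) := by
      refine IsUnit.pow _ (PowerSeries.isUnit_iff_constantCoeff.2 ?_)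
      simp [hc]
    refine ⟨hu, ?_⟩
    rw [← ehrhartSeries_mul_one_sub_pow hc, mul_assoc, Ring.mul_inverse_cancel _ hu, mul_one]
  · ext m
    rw [← coeff_qNumber_mul_sum hb m, eq_comm, ← sub_eq_zero, ← map_sub, ← mul_sub]
    exact PowerSeries.X_pow_dvd_iff.1
      ((X_pow_dvd_tsum_mul_X_pow_sub hb _ m).mul_left _) m (Nat.lt_succ_self m)
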